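/- Let $E$ be a real separable Banach space with dual $E^*$, and let $X$ be a centered Gaussian random vector with values in $E$, with covariance operator $C : E^* \to E$, $Cu = \mathbb{E}\, u(X) X$. Let $\xi_1, \xi_2, \dots$ be i.i.d. $N(0,1)$-distributed real random variables on some probability space. A sequence $(f_j)_{j \ge 1}$ in $E$ is called admissible for $X$ if $\sum_{j=1}^\infty \xi_j f_j$ converges almost surely in $E$ and its sum has the same distribution as $X$. A sequence $(e_j)_{j \ge 1}$ in a real Hilbert space $K$ is called a Parseval frame sequence if it is a Parseval frame for $K_0 := \overline{\mathrm{span}}\{e_j : j \ge 1\}$, that is, if for every $h \in K_0$ the series $\sum_{j=1}^\infty (e_j, h)_K\, e_j$ converges to $h$. Let $K$ be a real separable Hilbert space and $S : K \to E$ a continuous linear operator with adjoint $S^* : E^* \to K$, $(S^*u, k)_K = u(Sk)$, such that $C = S S^*$. (a) If $(e_j)_{j\ge 1}$ is a Parseval frame sequence in $K$ with $(\ker S)^\perp \subset \overline{\mathrm{span}}\{e_j : j \ge 1\}$, then $(S e_j)_{j\ge 1}$ is admissible for $X$. (b) Conversely, if $(f_j)_{j\ge 1}$ is admissible for $X$,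 then there exists a Parseval frame sequence $(e_j)_{j\ge 1}$ in $K$ with $(\ker S)^\perp = \overline{\mathrm{span}}\{e_j : j \ge 1\}$ such that $S e_j = f_j$ for every $j$. -/

import Mathlib

open MeasureTheory ProbabilityTheory Filter Topology

noncomputable section

namespace GaussianSeries

/-- The sequence `ξ` of real random variables on `(Ω', P')` is i.i.d. with standard normal
distribution `N(0,1)`. -/
structure IsStdGaussianSeq {Ω' : Type*} [MeasurableSpace Ω'] (ξ : ℕ → Ω' → ℝ)
    (P' : Measure Ω') : Prop where
  indep : iIndepFun ξ P'
  law : ∀ j, HasLaw (ξ j) (gaussianReal 0 1) P'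

/-- `X` is a centered Gaussian random vector on `(Ω, P)` with values in `E`. -/
structure IsCenteredGaussian {Ω E : Type*} [MeasurableSpace Ω]
    [NormedAddCommGroup E] [NormedSpace ℝ E] [MeasurableSpace E]
    (X : Ω → E) (P : Measure Ω) : Prop where
  gaussian : HasGaussianLaw X P
  centered : ∫ ω, X ω ∂P = 0

/-- The covariance operator `C : E* → E`, `C u = 𝔼 ⟨u, X⟩ X`. -/
def covarianceOperator {Ω E : Type*} [MeasurableSpace Ω]
    [NormedAddCommGroup E] [NormedSpace ℝ E]
    (X : Ω → E) (P : Measure Ω) (u : StrongDual ℝ E) : E :=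
  ∫ ω, u (X ω) • X ω ∂P

/-- The adjoint `S* : E* → K` of a continuous linear map `S : K → E` from a Hilbert space to a
Banach space, with `K` identified with its dual through the Riesz isomorphism. -/
def dualAdjoint {E K : Type*} [NormedAddCommGroup E] [NormedSpace ℝ E]
    [NormedAddCommGroup K] [InnerProductSpace ℝ K] [CompleteSpace K]
    (S : K →L[ℝ] E) (u : StrongDual ℝ E) : K :=
  (InnerProductSpace.toDual ℝ K).symm (u.comp S)

theorem inner_dualAdjoint {E K : Type*} [NormedAddCommGroup E] [NormedSpace ℝ E]
    [NormedAddCommGroup K] [InnerProductSpace ℝ K] [CompleteSpace K]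
    (S : K →L[ℝ] E) (u : StrongDual ℝ E) (k : K) :
    inner ℝ (dualAdjoint S u) k = u (S k) := by
  simp [dualAdjoint]

/-- `f` is admissible for `X`, with respect to the sequence `ξ` of random variables on
`(Ω', P')`: the series `∑ ξ j • f j` converges almost surely in `E`, and its sum has the same
distribution as `X`. -/
def IsAdmissible {Ω Ω' E : Type*} [MeasurableSpace Ω] [MeasurableSpace Ω']
    [NormedAddCommGroup E] [NormedSpace ℝ E] [MeasurableSpace E]
    (ξ : ℕ → Ω' → ℝ) (P' : Measure Ω') (f : ℕ → E) (X : Ω → E) (P : Measure Ω) : Prop :=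
  ∃ Y : Ω' → E,
    (∀ᵐ ω ∂P', Tendsto (fun n => ∑ j ∈ Finset.range n, ξ j ω • f j) atTop (𝓝 (Y ω))) ∧
    IdentDistrib X Y P P'

/-- `f` is a Parseval frame for `H`: for every `h` the series `∑ ⟨f j, h⟩ • f j` converges in `H`
with sum `h`. -/
def IsParsevalFrame {H : Type*} [NormedAddCommGroup H] [InnerProductSpace ℝ H]
    (f : ℕ → H) : Prop :=
  ∀ h : H, Tendsto (fun n => ∑ j ∈ Finset.range n, inner ℝ (f j) h • f j) atTop (𝓝 h)

/-- The closed linear span of a sequence. -/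
def closedSpan {K : Type*} [NormedAddCommGroup K] [InnerProductSpace ℝ K]
    (e : ℕ → K) : Submodule ℝ K :=
  (Submodule.span ℝ (Set.range e)).topologicalClosure

theorem mem_closedSpan {K : Type*} [NormedAddCommGroup K] [InnerProductSpace ℝ K]
    (e : ℕ → K) (j : ℕ) : e j ∈ closedSpan e :=
  Submodule.le_topologicalClosure _ (Submodule.subset_span (Set.mem_range_self j))

/-- `e` is a Parseval frame sequence in `K`: a Parseval frame for its own closed linear span. -/
def IsParsevalFrameSeq {K : Type*} [NormedAddCommGroup K] [InnerProductSpace ℝ K]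
    (e : ℕ → K) : Prop :=
  IsParsevalFrame (H := closedSpan e) (fun j => ⟨e j, mem_closedSpan e j⟩)

end GaussianSeries

end

namespace GaussianSeries

/-! Both halves pass through one criterion: `f` is admissible exactly when `∑ u(f_j)² = ‖S*u‖²` for
every functional `u`, the right side being the variance of `u(X)`.

Necessity compares characteristic functions: those of the partial sums of `∑ ξ_j u(f_j)` are `exp(-½
∑_{j<n} u(f_j)²)`, and that of `u(X)` is `exp(-½ ‖S*u‖²)`.

Sufficiency is an Itô–Nisio argument. For a countable separating family `u_k`, the scalar series `∑
ξ_j u_k(f_j)` have sums `U_k` whose joint law is that of `(u_k(X))_k`. Hence `(U_k)_k` almost surely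
lies in the image of `E` and comes from a random vector `Y` distributed as `X`. The partial sums of
`∑ ξ_j f_j` are the conditional expectations of `Y`, so they converge to `Y` by Lévy's theorem.

For (a), the criterion for `f_j = S e_j` is the Parseval identity at `S*u`, which lies in `(ker
S)^⊥`. For (b), the criterion gives `|u(f_j)| ≤ ‖S*u‖`, so Hahn–Banach and Riesz lift `f_j` to some
`e_j ∈ (ker S)^⊥`. The criterion is then the Parseval identity on the range of `S*`, which is dense
in `(ker S)^⊥`. -/

/-- **Lévy's upward theorem** for functions with values in a separable Banach space. -/
theorem tendsto_ae_condExp_of_stronglyMeasurable {Ω E : Type*} {m0 : MeasurableSpace Ω}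
    {μ : Measure Ω} [IsFiniteMeasure μ] [NormedAddCommGroup E] [NormedSpace ℝ E] [CompleteSpace E]
    [TopologicalSpace.SeparableSpace E] (ℱ : Filtration ℕ m0) {g : Ω → E} (hg : Integrable g μ)
    (hgm : StronglyMeasurable[⨆ n, ℱ n] g) :
    ∀ᵐ x ∂μ, Tendsto (fun n => (μ[g | ℱ n]) x) atTop (𝓝 (g x)) := by
  -- Conditional Jensen reduces to the scalar Lévy theorem for the distances from `g` to countably
  -- many dense points.
  have h1 : ∀ k : ℕ, ∀ᵐ x ∂μ, ∀ n : ℕ, ‖(μ[g | ℱ n]) x - TopologicalSpace.denseSeq E k‖ ≤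
      (μ[fun y => ‖g y - TopologicalSpace.denseSeq E k‖ | ℱ n]) x := by
    intro k
    rw [ae_all_iff]
    intro n
    have hs := condExp_sub hg (integrable_const (TopologicalSpace.denseSeq E k)) (ℱ n)
    have hn := norm_condExp_le (μ := μ) (m := ℱ n) (g - fun _ => TopologicalSpace.denseSeq E k)
    filter_upwards [hs, hn] with x hx hx'
    rw [hx] at hx'
    simpa [condExp_const (ℱ.le n)] using hx'
  have h2 : ∀ k : ℕ, ∀ᵐ x ∂μ, Tendsto
      (fun n => (μ[fun y => ‖g y - TopologicalSpace.denseSeq E k‖ | ℱ n]) x) atTop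
      (𝓝 ‖g x - TopologicalSpace.denseSeq E k‖) := fun k =>
    Integrable.tendsto_ae_condExp (hg.sub (integrable_const _)).norm
      (hgm.sub stronglyMeasurable_const).norm
  rw [← ae_all_iff] at h1 h2
  filter_upwards [h1, h2] with x hx1 hx2
  rw [Metric.tendsto_atTop]
  intro ε hε
  obtain ⟨k, hk⟩ := (TopologicalSpace.denseRange_denseSeq E).exists_dist_lt (g x)
    (show (0 : ℝ) < ε / 2 by positivity)
  rw [dist_eq_norm] at hk
  obtain ⟨N, hN⟩ := eventually_atTop.1 ((hx2 k).eventually_lt_const hk)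
  refine ⟨N, fun n hn => ?_⟩
  calc dist ((μ[g | ℱ n]) x) (g x)
      ≤ dist ((μ[g | ℱ n]) x) (TopologicalSpace.denseSeq E k)
        + dist (g x) (TopologicalSpace.denseSeq E k) := dist_triangle_right _ _ _
    _ < ε := by
      rw [dist_eq_norm, dist_eq_norm]
      linarith [hx1 k n, hN n hn]

/-! ### Scalar Gaussian series -/

section StdGaussianSeq

variable {Ω : Type*} [MeasurableSpace Ω] {P : Measure Ω} {ξ : ℕ → Ω → ℝ}

theorem IsStdGaussianSeq.congr {ξ' : ℕ → Ω → ℝ} (hξ : IsStdGaussianSeq ξ P)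
    (h : ∀ j, ξ j =ᵐ[P] ξ' j) : IsStdGaussianSeq ξ' P where
  indep := hξ.indep.congr h
  law j := (hξ.law j).congr (h j).symm

theorem IsStdGaussianSeq.memLp_two (hξ : IsStdGaussianSeq ξ P) (j : ℕ) : MemLp (ξ j) 2 P :=
  (hξ.law j).hasGaussianLaw.memLp_two

theorem IsStdGaussianSeq.integral_eq_zero (hξ : IsStdGaussianSeq ξ P) (j : ℕ) :
    ∫ ω, ξ j ω ∂P = 0 := by
  rw [(hξ.law j).integral_eq, integral_id_gaussianReal]

theorem IsStdGaussianSeq.integral_mul (hξ : IsStdGaussianSeq ξ P) (i j : ℕ) :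
    ∫ ω, ξ i ω * ξ j ω ∂P = if i = j then 1 else 0 := by
  split_ifs with h
  · subst h
    have hv := (hξ.law i).variance_eq
    rw [variance_of_integral_eq_zero (hξ.law i).aemeasurable (hξ.integral_eq_zero i),
      variance_id_gaussianReal] at hv
    simpa [sq] using hv
  · rw [(hξ.indep.indepFun h).integral_fun_mul_eq_mul_integral
      (hξ.law i).aemeasurable.aestronglyMeasurable (hξ.law j).aemeasurable.aestronglyMeasurable,
      hξ.integral_eq_zero, zero_mul]

theorem IsStdGaussianSeq.orthonormal (hξ : IsStdGaussianSeq ξ P) :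
    Orthonormal ℝ (fun j => (hξ.memLp_two j).toLp) := by
  rw [orthonormal_iff_ite]
  intro i j
  rw [L2.inner_def, ← hξ.integral_mul i j]
  refine integral_congr_ae ?_
  filter_upwards [(hξ.memLp_two i).coeFn_toLp, (hξ.memLp_two j).coeFn_toLp] with ω h1 h2
  rw [h1, h2]
  simp [mul_comm]

/-- A square summable series of i.i.d. standard Gaussian variables converges in `L²`. -/
theorem IsStdGaussianSeq.exists_tendsto_eLpNorm (hξ : IsStdGaussianSeq ξ P) {a : ℕ → ℝ}
    (ha : Summable fun j => a j ^ 2) :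
    ∃ V : Ω → ℝ, MemLp V 2 P ∧ Tendsto
      (fun n => eLpNorm ((fun ω => ∑ j ∈ Finset.range n, ξ j ω * a j) - V) 2 P) atTop (𝓝 0) := by
  have hs : Summable fun j => a j • (hξ.memLp_two j).toLp := by
    have := (hξ.orthonormal.orthogonalFamily).summable_iff_norm_sq_summable a
    simpa [ha] using this
  refine ⟨_, Lp.memLp (∑' j, a j • (hξ.memLp_two j).toLp), ?_⟩
  have ht := hs.hasSum.tendsto_sum_nat
  rw [Lp.tendsto_Lp_iff_tendsto_eLpNorm'] at ht
  refine ht.congr fun n => eLpNorm_congr_ae ?_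
  have hc : ∀ᵐ ω ∂P, ∀ j, ((hξ.memLp_two j).toLp : Ω → ℝ) ω = ξ j ω :=
    ae_all_iff.2 fun j => (hξ.memLp_two j).coeFn_toLp
  have hc2 : ∀ᵐ ω ∂P, ∀ j, ((a j • (hξ.memLp_two j).toLp : Lp ℝ 2 P) : Ω → ℝ) ω =
      a j * ((hξ.memLp_two j).toLp : Ω → ℝ) ω :=
    ae_all_iff.2 fun j => Lp.coeFn_smul _ _
  filter_upwards [hc, hc2, Lp.coeFn_finsetSum (Finset.range n) fun j => a j • (hξ.memLp_two j).toLp]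
    with ω h1 h2 h3
  simp only [Pi.sub_apply, h3, Finset.sum_apply, h2, h1, mul_comm]

/-- The sum of a square summable series of i.i.d. standard Gaussian variables closes the martingale
of its partial sums. -/
theorem IsStdGaussianSeq.exists_condExp_eq_sum [IsProbabilityMeasure P]
    (hξ : IsStdGaussianSeq ξ P) (hm : ∀ j, StronglyMeasurable (ξ j)) {a : ℕ → ℝ}
    (ha : Summable fun j => a j ^ 2) :
    ∃ U : Ω → ℝ, StronglyMeasurable[⨆ n, Filtration.natural ξ hm n] U ∧ Integrable U P ∧
      ∀ n, P[U | Filtration.natural ξ hm n] =ᵐ[P]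
        fun ω => ∑ j ∈ Finset.range (n + 1), ξ j ω * a j := by
  obtain ⟨V, hV, hVt⟩ := hξ.exists_tendsto_eLpNorm ha
  have hint : ∀ j, Integrable (ξ j) P := fun j => (hξ.memLp_two j).integrable one_le_two
  have hVi : Integrable V P := hV.integrable one_le_two
  have hSi : ∀ n, Integrable (fun ω => ∑ j ∈ Finset.range n, ξ j ω * a j) P := fun n =>
    integrable_finsetSum _ fun j _ => (hint j).mul_const _
  have hterm : ∀ n j, P[fun ω => ξ j ω * a j | Filtration.natural ξ hm n] =ᵐ[P]
      fun ω => if j ≤ n then ξ j ω * a j else 0 := by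
    intro n j
    split_ifs with h
    · rw [condExp_of_stronglyMeasurable ((Filtration.natural ξ hm).le n) _ ((hint j).mul_const _)]
      exact (((Filtration.stronglyAdapted_natural hm) j).mono
        ((Filtration.natural ξ hm).mono h)).mul_const _
    · have h1 := hξ.indep.condExp_natural_ae_eq_of_lt hm (not_le.1 h)
      have h2 := condExp_smul (μ := P) (a j) (ξ j) (Filtration.natural ξ hm n)
      have h3 : (fun ω => ξ j ω * a j) = a j • ξ j := by
        ext ω; simp [mul_comm]
      rw [h3]
      filter_upwards [h1, h2] with ω h1 h2
      rw [h2, Pi.smul_apply, h1, hξ.integral_eq_zero, smul_zero]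
  have hsum : ∀ n m, n + 1 ≤ m → P[fun ω => ∑ j ∈ Finset.range m, ξ j ω * a j |
      Filtration.natural ξ hm n] =ᵐ[P] fun ω => ∑ j ∈ Finset.range (n + 1), ξ j ω * a j := by
    intro n m hnm
    have h1 := condExp_finsetSum (μ := P) (s := Finset.range m) (f := fun j ω => ξ j ω * a j)
      (fun j _ => (hint j).mul_const _) (Filtration.natural ξ hm n)
    have h2 : (∑ j ∈ Finset.range m, fun ω => ξ j ω * a j) =
        fun ω => ∑ j ∈ Finset.range m, ξ j ω * a j := by
      ext ω; simp
    rw [h2] at h1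
    filter_upwards [h1, ae_all_iff.2 (hterm n)] with ω h1 h3
    rw [h1, Finset.sum_apply, Finset.sum_congr rfl fun j _ => h3 j, ← Finset.sum_filter]
    refine Finset.sum_congr ?_ fun _ _ => rfl
    ext j
    simp only [Finset.mem_filter, Finset.mem_range]
    omega
  -- Projecting the `L²` limit `V` makes it measurable for the generated σ-algebra, as Lévy's
  -- theorem requires.
  refine ⟨P[V | ⨆ n, Filtration.natural ξ hm n], stronglyMeasurable_condExp, integrable_condExp,
    fun n => ?_⟩
  refine (condExp_condExp_of_le (le_iSup _ n)
    (iSup_le fun n => (Filtration.natural ξ hm).le n)).trans ?_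
  -- The left side does not depend on `m`, and the right side tends to `0`.
  have hle : ∀ m, n + 1 ≤ m → eLpNorm (P[V | Filtration.natural ξ hm n] -
      fun ω => ∑ j ∈ Finset.range (n + 1), ξ j ω * a j) 1 P ≤
      eLpNorm ((fun ω => ∑ j ∈ Finset.range m, ξ j ω * a j) - V) 2 P := by
    intro m hnm
    calc _ = eLpNorm (P[V - (fun ω => ∑ j ∈ Finset.range m, ξ j ω * a j) |
            Filtration.natural ξ hm n]) 1 P := by
          refine eLpNorm_congr_ae ?_
          filter_upwards [condExp_sub hVi (hSi m) (Filtration.natural ξ hm n), hsum n m hnm]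
            with ω h1 h2
          rw [h1, Pi.sub_apply, Pi.sub_apply, h2]
      _ ≤ eLpNorm (V - (fun ω => ∑ j ∈ Finset.range m, ξ j ω * a j)) 1 P :=
          eLpNorm_condExp_le_eLpNorm _ le_rfl
      _ ≤ eLpNorm (V - (fun ω => ∑ j ∈ Finset.range m, ξ j ω * a j)) 2 P :=
          eLpNorm_le_eLpNorm_of_exponent_le one_le_two (hVi.sub (hSi m)).aestronglyMeasurable
      _ = _ := eLpNorm_sub_comm _ _ _ _
  have h0 := ge_of_tendsto hVt (eventually_atTop.2 ⟨n + 1, hle⟩)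
  rw [nonpos_iff_eq_zero, eLpNorm_eq_zero_iff
    (integrable_condExp.sub (hSi _)).aestronglyMeasurable one_ne_zero] at h0
  exact sub_ae_eq_zero _ _ |>.1 h0

/-- Characteristic function of the partial sums of a Gaussian series. -/
theorem IsStdGaussianSeq.integral_exp_sum (hξ : IsStdGaussianSeq ξ P) (a : ℕ → ℝ) (n : ℕ) :
    ∫ ω, Complex.exp (((∑ j ∈ Finset.range n, ξ j ω * a j : ℝ) : ℂ) * Complex.I) ∂P =
      Real.exp (-(∑ j ∈ Finset.range n, a j ^ 2) / 2) := by
  have hmeas : ∀ j, AEMeasurable (fun ω => ξ j ω * a j) P := fun j =>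
    (hξ.law j).aemeasurable.mul_const _
  have hind : iIndepFun (fun j ω => ξ j ω * a j) P :=
    hξ.indep.comp (fun j x => x * a j) fun j => measurable_id.mul_const _
  have h := (hind.restrict (Finset.range n)).charFun_map_fun_finsetSum_eq_prod fun j _ => hmeas j
  have h1 := congrFun h 1
  rw [charFun_apply_real, integral_map (Finset.aemeasurable_fun_sum _ fun j _ => hmeas j)
    (by fun_prop)] at h1
  simp only [Complex.ofReal_one, one_mul] at h1
  rw [h1, Finset.prod_apply]
  have h2 : ∀ j, charFun (P.map fun ω => ξ j ω * a j) 1 = Complex.exp (-(a j : ℂ) ^ 2 / 2) := by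
    intro j
    rw [(gaussianReal_mul_const (hξ.law j) (a j)).map_eq, charFun_gaussianReal]
    simp
    ring_nf
  simp only [h2, ← Complex.exp_sum]
  push_cast
  rw [← Finset.sum_div, Finset.sum_neg_distrib]

/-- Dominated convergence applied to the partial sums. Square summability is not assumed, so this
serves both directions of the criterion. -/
theorem IsStdGaussianSeq.tendsto_exp_sum_sq [IsProbabilityMeasure P] (hξ : IsStdGaussianSeq ξ P)
    {a : ℕ → ℝ} {W : Ω → ℝ}
    (hW : ∀ᵐ ω ∂P, Tendsto (fun n => ∑ j ∈ Finset.range n, ξ j ω * a j) atTop (𝓝 (W ω))) :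
    Tendsto (fun n => ((Real.exp (-(∑ j ∈ Finset.range n, a j ^ 2) / 2) : ℝ) : ℂ)) atTop
      (𝓝 (∫ ω, Complex.exp ((W ω : ℂ) * Complex.I) ∂P)) := by
  have hmeas : ∀ n, AEMeasurable (fun ω => ∑ j ∈ Finset.range n, ξ j ω * a j) P := fun n =>
    Finset.aemeasurable_fun_sum _ fun j _ => (hξ.law j).aemeasurable.mul_const _
  refine Tendsto.congr (hξ.integral_exp_sum a) ?_
  refine tendsto_integral_of_dominated_convergence (fun _ => 1) (fun n => ?_)
    (integrable_const _) (fun n => ?_) ?_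
  · have := hmeas n
    exact AEMeasurable.aestronglyMeasurable (by fun_prop)
  · exact .of_forall fun ω => (Complex.norm_exp_ofReal_mul_I _).le
  · filter_upwards [hW] with ω hω
    have : Continuous fun x : ℝ => Complex.exp ((x : ℂ) * Complex.I) := by fun_prop
    exact (this.tendsto _).comp hω

end StdGaussianSeq

/-! ### The adjoint and the kernel of `S` -/

section DualAdjoint

variable {E K : Type*} [NormedAddCommGroup E] [NormedSpace ℝ E]
  [NormedAddCommGroup K] [InnerProductSpace ℝ K] [CompleteSpace K]

/-- The adjoint `S* : E* → K` as a linear map. -/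
noncomputable def dualAdjointLinear (S : K →L[ℝ] E) : StrongDual ℝ E →ₗ[ℝ] K where
  toFun := dualAdjoint S
  map_add' u v := by
    refine ext_inner_right ℝ fun k => ?_
    simp [inner_add_left, inner_dualAdjoint]
  map_smul' c u := by
    refine ext_inner_right ℝ fun k => ?_
    simp [inner_smul_left, inner_dualAdjoint]

@[simp]
theorem dualAdjointLinear_apply (S : K →L[ℝ] E) (u : StrongDual ℝ E) :
    dualAdjointLinear S u = dualAdjoint S u := rfl

theorem ker_eq_orthogonal_range_dualAdjointLinear (S : K →L[ℝ] E) :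
    LinearMap.ker S.toLinearMap = (LinearMap.range (dualAdjointLinear S))ᗮ := by
  ext k
  rw [LinearMap.mem_ker, Submodule.mem_orthogonal]
  constructor
  · rintro h _ ⟨u, rfl⟩
    have h' : S k = 0 := h
    rw [dualAdjointLinear_apply, inner_dualAdjoint, h', map_zero]
  · intro h
    refine SeparatingDual.eq_zero_of_forall_dual_eq_zero (R := ℝ) fun u => ?_
    have := h _ ⟨u, rfl⟩
    rwa [dualAdjointLinear_apply, inner_dualAdjoint] at this

theorem orthogonal_ker_eq_closure_range (S : K →L[ℝ] E) :
    (LinearMap.ker S.toLinearMap)ᗮ =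
      (LinearMap.range (dualAdjointLinear S)).topologicalClosure := by
  rw [ker_eq_orthogonal_range_dualAdjointLinear, Submodule.orthogonal_orthogonal_eq_closure]

theorem dualAdjoint_mem_orthogonal_ker (S : K →L[ℝ] E) (u : StrongDual ℝ E) :
    dualAdjoint S u ∈ (LinearMap.ker S.toLinearMap)ᗮ := by
  rw [orthogonal_ker_eq_closure_range]
  exact Submodule.le_topologicalClosure _ ⟨u, rfl⟩

/-- If evaluation at `f` is dominated by the norm of `S*`, then `f` is in the range of `S`. -/
theorem exists_mem_orthogonal_ker_apply_eq (S : K →L[ℝ] E) (f : E)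
    (hf : ∀ u : StrongDual ℝ E, |u f| ≤ ‖dualAdjoint S u‖) :
    ∃ k ∈ (LinearMap.ker S.toLinearMap)ᗮ, S k = f := by
  let D := dualAdjointLinear S
  let φ : StrongDual ℝ E →ₗ[ℝ] ℝ :=
    { toFun := fun u => u f, map_add' := fun _ _ => rfl, map_smul' := fun _ _ => rfl }
  have hker : LinearMap.ker D.rangeRestrict ≤ LinearMap.ker φ := by
    intro u hu
    rw [LinearMap.ker_rangeRestrict, LinearMap.mem_ker] at hu
    have h0 := hf u
    rw [show dualAdjoint S u = 0 from hu, norm_zero] at h0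
    exact abs_nonpos_iff.1 h0
  -- The functional `S*u ↦ u(f)`, well defined by `hker` and a contraction by `hf`.
  let ψ : LinearMap.range D →ₗ[ℝ] ℝ :=
    (LinearMap.ker D.rangeRestrict).liftQ φ hker ∘ₗ
      (D.rangeRestrict.quotKerEquivOfSurjective D.surjective_rangeRestrict).symm.toLinearMap
  have hψ : ∀ u, ψ (D.rangeRestrict u) = u f := by
    intro u
    have : (D.rangeRestrict.quotKerEquivOfSurjective D.surjective_rangeRestrict).symm
        (D.rangeRestrict u) = Submodule.Quotient.mk u := by
      rw [LinearEquiv.symm_apply_eq]; rfl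
    simp only [ψ, LinearMap.comp_apply, LinearEquiv.coe_coe, this]
    rfl
  have hbound : ∀ x, ‖ψ x‖ ≤ 1 * ‖x‖ := by
    intro x
    obtain ⟨u, rfl⟩ := D.surjective_rangeRestrict x
    rw [hψ, one_mul]
    exact hf u
  obtain ⟨g, hg, -⟩ := exists_extension_norm_eq _ (ψ.mkContinuous 1 hbound)
  let k := (InnerProductSpace.toDual ℝ K).symm g
  have hk : S k = f := by
    refine (SeparatingDual.eq_iff_forall_dual_eq (R := ℝ)).2 fun u => ?_
    rw [← inner_dualAdjoint, real_inner_comm, InnerProductSpace.toDual_symm_apply]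
    have := hg (D.rangeRestrict u)
    rw [LinearMap.mkContinuous_apply, hψ] at this
    exact this
  have hc : IsClosed (LinearMap.ker S.toLinearMap : Set K) := S.isClosed_ker
  have : CompleteSpace (LinearMap.ker S.toLinearMap) := hc.completeSpace_coe
  -- Removing the kernel component leaves the value of `S` unchanged.
  refine ⟨k - (LinearMap.ker S.toLinearMap).starProjection k,
    Submodule.sub_starProjection_mem_orthogonal k, ?_⟩
  have h0 : S ((LinearMap.ker S.toLinearMap).starProjection k) = 0 :=
    LinearMap.mem_ker.1 (Submodule.starProjection_apply_mem _ k)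
  rw [map_sub, h0, sub_zero, hk]

end DualAdjoint

/-! ### Parseval frames -/

section Parseval

variable {K : Type*} [NormedAddCommGroup K] [InnerProductSpace ℝ K]

theorem IsParsevalFrameSeq.tendsto_sum_inner_sq {e : ℕ → K} (he : IsParsevalFrameSeq e) {h : K}
    (hh : h ∈ closedSpan e) :
    Tendsto (fun n => ∑ j ∈ Finset.range n, inner ℝ (e j) h ^ 2) atTop (𝓝 (‖h‖ ^ 2)) := by
  have h1 := (he ⟨h, hh⟩).inner (𝕜 := ℝ) (tendsto_const_nhds (x := (⟨h, hh⟩ : closedSpan e)))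
  rw [real_inner_self_eq_norm_sq] at h1
  refine h1.congr fun n => ?_
  rw [sum_inner]
  refine Finset.sum_congr rfl fun j _ => ?_
  rw [real_inner_smul_left, sq]
  rfl

/-- The remainder of the frame expansion of `h` along the first `n` terms of `e`. -/
noncomputable def frameRemainder (e : ℕ → K) (n : ℕ) : K →L[ℝ] K :=
  ContinuousLinearMap.id ℝ K - ∑ j ∈ Finset.range n, (innerSL ℝ (e j)).smulRight (e j)

theorem frameRemainder_apply (e : ℕ → K) (n : ℕ) (h : K) :
    frameRemainder e n h = h - ∑ j ∈ Finset.range n, inner ℝ (e j) h • e j := by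
  simp [frameRemainder]

theorem inner_frameRemainder (e : ℕ → K) (n : ℕ) (h k : K) :
    inner ℝ (frameRemainder e n h) k =
      inner ℝ h k - ∑ j ∈ Finset.range n, inner ℝ (e j) h * inner ℝ (e j) k := by
  simp [frameRemainder_apply, inner_sub_left, sum_inner, real_inner_smul_left]

theorem inner_frameRemainder_self (e : ℕ → K) (n : ℕ) (h : K) :
    inner ℝ (frameRemainder e n h) h = ‖h‖ ^ 2 - ∑ j ∈ Finset.range n, inner ℝ (e j) h ^ 2 := by
  simp [inner_frameRemainder, sq]

/-- Bessel's inequality on a subspace bounds the remainder of the frame expansion. -/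
theorem norm_frameRemainder_sq_le {e : ℕ → K} {H : Submodule ℝ K} (he : ∀ j, e j ∈ H) (n : ℕ)
    (hB : ∀ h ∈ H, ∑ j ∈ Finset.range n, inner ℝ (e j) h ^ 2 ≤ ‖h‖ ^ 2) {h : K} (hh : h ∈ H) :
    ‖frameRemainder e n h‖ ^ 2 ≤ ‖h‖ ^ 2 - ∑ j ∈ Finset.range n, inner ℝ (e j) h ^ 2 := by
  set k := frameRemainder e n h with hk
  have hkH : k ∈ H := by
    rw [hk, frameRemainder_apply]
    exact H.sub_mem hh (H.sum_mem fun j _ => H.smul_mem _ (he j))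
  -- With `T` the remainder operator and `k = Th`, Bessel says `⟨T(h-k), h-k⟩ ≥ 0`. Symmetry turns
  -- this into `⟨k,h⟩ - 2‖k‖² + ⟨Tk,k⟩ ≥ 0`, and `⟨Tk,k⟩ ≤ ‖k‖²` finishes.
  have h1 := sub_nonneg.2 (hB _ (H.sub_mem hh hkH))
  rw [← inner_frameRemainder_self, map_sub, inner_sub_left, inner_sub_right, inner_sub_right,
    ← hk] at h1
  have h2 : inner ℝ (frameRemainder e n k) h = inner ℝ k k := by
    rw [inner_frameRemainder, real_inner_comm]
    conv_rhs => rw [hk, inner_frameRemainder]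
    rw [← hk]
    simp only [mul_comm]
  have h3 : inner ℝ (frameRemainder e n k) k ≤ inner ℝ k k := by
    rw [inner_frameRemainder_self, real_inner_self_eq_norm_sq]
    exact sub_le_self _ (Finset.sum_nonneg fun j _ => sq_nonneg _)
  rw [← inner_frameRemainder_self, ← hk, ← real_inner_self_eq_norm_sq]
  linarith

/-- A sequence in the closure of a subspace `R` satisfying the Parseval identity on `R` is a
Parseval frame for the closure of `R`. -/
theorem isParsevalFrameSeq_of_tendsto {e : ℕ → K} {R : Submodule ℝ K}
    (he : ∀ j, e j ∈ R.topologicalClosure)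
    (hR : ∀ h ∈ R, Tendsto (fun n => ∑ j ∈ Finset.range n, inner ℝ (e j) h ^ 2) atTop
      (𝓝 (‖h‖ ^ 2))) :
    IsParsevalFrameSeq e ∧ closedSpan e = R.topologicalClosure := by
  have hmono : ∀ h, Monotone fun n => ∑ j ∈ Finset.range n, inner ℝ (e j) h ^ 2 := fun h =>
    monotone_nat_of_le_succ fun n => by
      rw [Finset.sum_range_succ]
      exact le_add_of_nonneg_right (sq_nonneg _)
  -- Bessel's inequality is a closed condition, so it passes to the closure. It makes the remainders
  -- contractions there, so their convergence to `0` extends from `R` by density.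
  have hB : ∀ n, ∀ h ∈ R.topologicalClosure,
      ∑ j ∈ Finset.range n, inner ℝ (e j) h ^ 2 ≤ ‖h‖ ^ 2 := by
    intro n h hh
    have hc : IsClosed {h : K | ∑ j ∈ Finset.range n, inner ℝ (e j) h ^ 2 ≤ ‖h‖ ^ 2} :=
      isClosed_le (by fun_prop) (by fun_prop)
    exact hc.closure_subset_iff.2 (fun x hx => (hmono x).ge_of_tendsto (hR x hx) n) hh
  have hle : ∀ n, ∀ h ∈ R.topologicalClosure, ‖frameRemainder e n h‖ ≤ ‖h‖ := by
    intro n h hh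
    refine le_of_pow_le_pow_left₀ two_ne_zero (norm_nonneg _) ((norm_frameRemainder_sq_le he n (hB n) hh).trans
      (sub_le_self _ (Finset.sum_nonneg fun j _ => sq_nonneg _)))
  have h0R : ∀ h ∈ R, Tendsto (fun n => ‖frameRemainder e n h‖) atTop (𝓝 0) := by
    intro h hh
    have h1 : Tendsto (fun n => ‖frameRemainder e n h‖ ^ 2) atTop (𝓝 0) := by
      refine squeeze_zero (fun _ => sq_nonneg _) (fun n => norm_frameRemainder_sq_le he n (hB n)
        (R.le_topologicalClosure hh)) ?_
      have h2 := (hR h hh).const_sub (‖h‖ ^ 2)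
      rwa [sub_self] at h2
    simpa using h1.sqrt
  have h0 : ∀ h ∈ R.topologicalClosure,
      Tendsto (fun n => frameRemainder e n h) atTop (𝓝 0) := by
    intro h hh
    rw [tendsto_zero_iff_norm_tendsto_zero, Metric.tendsto_atTop]
    intro ε hε
    obtain ⟨x, hx, hxh⟩ := Metric.mem_closure_iff.1 hh (ε / 2) (by positivity)
    obtain ⟨N, hN⟩ := eventually_atTop.1 ((h0R x hx).eventually_lt_const
      (show (0 : ℝ) < ε / 2 by positivity))
    refine ⟨N, fun n hn => ?_⟩
    rw [Real.dist_eq, sub_zero, abs_norm]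
    calc ‖frameRemainder e n h‖ = ‖frameRemainder e n (h - x) + frameRemainder e n x‖ := by
          rw [← map_add, sub_add_cancel]
      _ ≤ ‖h - x‖ + ‖frameRemainder e n x‖ := (norm_add_le _ _).trans (add_le_add_left
          (hle n _ (Submodule.sub_mem _ hh (R.le_topologicalClosure hx))) _)
      _ < ε := by
        rw [dist_eq_norm] at hxh
        linarith [hN n hn]
  have hexp : ∀ h ∈ R.topologicalClosure,
      Tendsto (fun n => ∑ j ∈ Finset.range n, inner ℝ (e j) h • e j) atTop (𝓝 h) := by
    intro h hh
    have := (h0 h hh).const_sub h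
    simpa [frameRemainder_apply] using this
  have hspan : closedSpan e = R.topologicalClosure := by
    refine le_antisymm ?_ fun h hh => ?_
    · refine Submodule.topologicalClosure_minimal _ ?_ R.isClosed_topologicalClosure
      rw [Submodule.span_le]
      rintro _ ⟨j, rfl⟩
      exact he j
    · refine (Submodule.isClosed_topologicalClosure _).mem_of_tendsto (hexp h hh)
        (.of_forall fun n => ?_)
      exact Submodule.sum_mem _ fun j _ => Submodule.smul_mem _ _ (mem_closedSpan e j)
  refine ⟨fun h => ?_, hspan⟩
  rw [tendsto_subtype_rng]
  have := hexp h (hspan ▸ h.2)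
  refine this.congr fun n => ?_
  simp

end Parseval

/-! ### Weak variances and characteristic function of `X` -/

section Covariance

variable {Ω E K : Type*} [MeasurableSpace Ω] {P : Measure Ω} [NormedAddCommGroup E]
  [NormedSpace ℝ E] [CompleteSpace E] [TopologicalSpace.SeparableSpace E] [MeasurableSpace E]
  [BorelSpace E] [NormedAddCommGroup K] [InnerProductSpace ℝ K] [CompleteSpace K]
  {X : Ω → E} {S : K →L[ℝ] E}

theorem IsCenteredGaussian.integral_dual_eq_zero (hX : IsCenteredGaussian X P)
    (u : StrongDual ℝ E) : ∫ ω, u (X ω) ∂P = 0 := by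
  have := UniformSpace.secondCountable_of_separable E
  rw [u.integral_comp_comm hX.gaussian.integrable, hX.centered, map_zero]

theorem IsCenteredGaussian.apply_covarianceOperator (hX : IsCenteredGaussian X P)
    (u : StrongDual ℝ E) : u (covarianceOperator X P u) = ∫ ω, u (X ω) ^ 2 ∂P := by
  have := UniformSpace.secondCountable_of_separable E
  have hi : Integrable (fun ω => u (X ω) • X ω) P :=
    memLp_one_iff_integrable.1 (hX.gaussian.memLp_two.smul (hX.gaussian.map_fun u).memLp_two)
  rw [covarianceOperator, ← u.integral_comp_comm hi]
  simp [sq]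

theorem IsCenteredGaussian.variance_dual (hX : IsCenteredGaussian X P)
    (hS : ∀ u : StrongDual ℝ E, covarianceOperator X P u = S (dualAdjoint S u))
    (u : StrongDual ℝ E) : Var[fun ω => u (X ω); P] = ‖dualAdjoint S u‖ ^ 2 := by
  rw [variance_of_integral_eq_zero (hX.gaussian.map_fun u).aemeasurable
    (hX.integral_dual_eq_zero u), ← hX.apply_covarianceOperator, hS, ← inner_dualAdjoint,
    real_inner_self_eq_norm_sq]

theorem IsCenteredGaussian.integral_exp_dual (hX : IsCenteredGaussian X P)
    (hS : ∀ u : StrongDual ℝ E, covarianceOperator X P u = S (dualAdjoint S u))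
    (u : StrongDual ℝ E) : ∫ ω, Complex.exp ((u (X ω) : ℂ) * Complex.I) ∂P =
      Real.exp (-‖dualAdjoint S u‖ ^ 2 / 2) := by
  have h := hX.gaussian.charFunDual_map_eq_fun u
  rw [charFunDual_apply, integral_map hX.gaussian.aemeasurable (by fun_prop),
    hX.integral_dual_eq_zero, hX.variance_dual hS] at h
  rw [h]
  push_cast
  ring_nf

end Covariance

/-- Norming functionals of a dense sequence separate points: if all vanish at `z`, any dense point
`d` has `‖d‖ ≤ ‖z - d‖`, which forces `z = 0`. -/
theorem exists_seq_dual_injective (E : Type*) [NormedAddCommGroup E] [NormedSpace ℝ E]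
    [TopologicalSpace.SeparableSpace E] :
    ∃ u : ℕ → StrongDual ℝ E, Function.Injective fun x k => u k x := by
  choose u hu hux using fun k : ℕ => exists_dual_vector'' ℝ (TopologicalSpace.denseSeq E k)
  refine ⟨u, fun x y hxy => ?_⟩
  rw [← sub_eq_zero, ← norm_le_zero_iff]
  refine le_of_forall_pos_le_add fun ε hε => ?_
  obtain ⟨k, hk⟩ := (TopologicalSpace.denseRange_denseSeq E).exists_dist_lt (x - y)
    (show (0 : ℝ) < ε / 2 by positivity)
  rw [dist_eq_norm] at hk
  have h0 : u k (x - y) = 0 := by rw [map_sub, sub_eq_zero]; exact congrFun hxy k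
  have h1 : ‖TopologicalSpace.denseSeq E k‖ ≤ ‖x - y - TopologicalSpace.denseSeq E k‖ := by
    have h2 : u k (x - y - TopologicalSpace.denseSeq E k) = -‖TopologicalSpace.denseSeq E k‖ := by
      rw [map_sub, h0, hux]; simp
    calc ‖TopologicalSpace.denseSeq E k‖ = ‖u k (x - y - TopologicalSpace.denseSeq E k)‖ := by
          rw [h2, norm_neg, norm_norm]
      _ ≤ 1 * ‖x - y - TopologicalSpace.denseSeq E k‖ := (u k).le_of_opNorm_le (hu k) _
      _ = _ := one_mul _
  linarith [norm_le_insert' (x - y) (TopologicalSpace.denseSeq E k)]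

/-! ### Admissibility and weak variances -/

variable {Ω Ω' E K : Type*} [MeasurableSpace Ω] [MeasurableSpace Ω'] {P : Measure Ω}
  {P' : Measure Ω'} [NormedAddCommGroup E] [NormedSpace ℝ E] [MeasurableSpace E]
  {X : Ω → E} {ξ : ℕ → Ω' → ℝ} {f : ℕ → E}

theorem IsAdmissible.congr {ξ' : ℕ → Ω' → ℝ} (h : IsAdmissible ξ P' f X P)
    (hξ : ∀ j, ξ j =ᵐ[P'] ξ' j) : IsAdmissible ξ' P' f X P := by
  obtain ⟨Y, hY, hXY⟩ := h
  refine ⟨Y, ?_, hXY⟩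
  filter_upwards [hY, ae_all_iff.2 hξ] with ω h1 h2
  simpa only [h2] using h1

variable [CompleteSpace E] [TopologicalSpace.SeparableSpace E] [BorelSpace E]
  [NormedAddCommGroup K] [InnerProductSpace ℝ K] [CompleteSpace K] {S : K →L[ℝ] E}
  [IsProbabilityMeasure P']

/-- The joint law of the coordinates of a Gaussian vector is the joint law of the sums of the
coordinate series. -/
theorem map_dual_eq_map_of_tendsto (hX : IsCenteredGaussian X P) (hξ : IsStdGaussianSeq ξ P')
    (hS : ∀ u : StrongDual ℝ E, covarianceOperator X P u = S (dualAdjoint S u))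
    (hf : ∀ u : StrongDual ℝ E, Tendsto (fun n => ∑ j ∈ Finset.range n, u (f j) ^ 2) atTop
      (𝓝 (‖dualAdjoint S u‖ ^ 2)))
    {u : ℕ → StrongDual ℝ E} {U : ℕ → Ω' → ℝ} (hUm : ∀ k, Measurable (U k))
    (hU : ∀ k, ∀ᵐ ω ∂P', Tendsto (fun n => ∑ j ∈ Finset.range n, ξ j ω * u k (f j)) atTop
      (𝓝 (U k ω))) :
    P.map (fun ω k => u k (X ω)) = P'.map (fun ω k => U k ω) := by
  have := hX.gaussian.isProbabilityMeasure
  have hXm := hX.gaussian.aemeasurable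
  have hXk : AEMeasurable (fun ω k => u k (X ω)) P := aemeasurable_pi_lambda _ fun k => by fun_prop
  have hUk : Measurable (fun ω k => U k ω) := measurable_pi_lambda _ hUm
  -- Finite-dimensional marginals determine the law on the product; they are compared by the
  -- Cramér–Wold device, `v` being the combination of the `u i` induced by `L`.
  refine (isProjectiveLimit_map (X := fun k ω => u k (X ω)) hXk).unique fun I => ?_
  rw [Measure.map_map (by fun_prop) hUk]
  refine Measure.ext_of_charFunDual (funext fun L => ?_)
  let c : I → ℝ := fun i => L (Pi.single i 1)
  have hL : ∀ x : I → ℝ, L x = ∑ i, x i * c i := fun x => by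
    conv_lhs => rw [pi_eq_sum_univ' x]
    simp [c, Pi.single]
  let v : StrongDual ℝ E := ∑ i : I, c i • u i
  have hv : ∀ x, v x = ∑ i : I, u i x * c i := fun x => by
    simp [v, mul_comm]
  have hXI : AEMeasurable (fun ω => I.restrict fun k => u k (X ω)) P :=
    (Finset.measurable_restrict I).comp_aemeasurable hXk
  rw [charFunDual_apply, charFunDual_apply, integral_map hXI (by fun_prop),
    integral_map ((Finset.measurable_restrict I).comp hUk).aemeasurable (by fun_prop)]
  symm
  have hW : ∀ᵐ ω ∂P', Tendsto (fun n => ∑ j ∈ Finset.range n, ξ j ω * v (f j)) atTop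
      (𝓝 (L (I.restrict fun k => U k ω))) := by
    filter_upwards [ae_all_iff.2 hU] with ω hω
    rw [hL]
    refine (tendsto_finsetSum Finset.univ fun (i : I) _ => (hω i).mul_const (c i)).congr fun n => ?_
    simp only [hv, Finset.mul_sum, Finset.sum_mul]
    rw [Finset.sum_comm]
    simp only [mul_assoc]
  have h1 := hξ.tendsto_exp_sum_sq hW
  have h2 : Tendsto (fun n => ((Real.exp (-(∑ j ∈ Finset.range n, v (f j) ^ 2) / 2) : ℝ) : ℂ))
      atTop (𝓝 (Real.exp (-‖dualAdjoint S v‖ ^ 2 / 2) : ℝ)) :=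
    (Complex.continuous_ofReal.tendsto _).comp
      ((Real.continuous_exp.tendsto _).comp ((hf v).neg.div_const 2))
  have h3 := (hX.integral_exp_dual hS v).trans (tendsto_nhds_unique h2 h1)
  refine Eq.trans ?_ h3
  refine integral_congr_ae (.of_forall fun ω => ?_)
  simp only [hL, hv]
  rfl

/-- A series whose weak variances are those of `X` is admissible for `X`. -/
theorem isAdmissible_of_tendsto (hX : IsCenteredGaussian X P) (hξ : IsStdGaussianSeq ξ P')
    (hS : ∀ u : StrongDual ℝ E, covarianceOperator X P u = S (dualAdjoint S u))
    (hf : ∀ u : StrongDual ℝ E, Tendsto (fun n => ∑ j ∈ Finset.range n, u (f j) ^ 2) atTop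
      (𝓝 (‖dualAdjoint S u‖ ^ 2))) :
    IsAdmissible ξ P' f X P := by
  -- The natural filtration needs measurable `ξ j`, not just almost everywhere measurable ones.
  wlog hm : ∀ j, StronglyMeasurable (ξ j) generalizing ξ
  · have hae : ∀ j, ξ j =ᵐ[P'] (hξ.law j).aemeasurable.mk (ξ j) := fun j =>
      (hξ.law j).aemeasurable.ae_eq_mk
    exact (this (hξ.congr hae) fun j =>
      (hξ.law j).aemeasurable.measurable_mk.stronglyMeasurable).congr fun j => (hae j).symm
  have := UniformSpace.secondCountable_of_separable E
  obtain ⟨u, hu⟩ := exists_seq_dual_injective E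
  have hsum : ∀ k, Summable fun j => u k (f j) ^ 2 := fun k =>
    ((hasSum_iff_tendsto_nat_of_nonneg (fun _ => sq_nonneg _) _).2 (hf (u k))).summable
  choose U hUm hUi hU using fun k => hξ.exists_condExp_eq_sum hm (hsum k)
  let ℱ := Filtration.natural ξ hm
  have hℱ : ⨆ n, ℱ n ≤ ‹MeasurableSpace Ω'› := iSup_le ℱ.le
  have hUt : ∀ k, ∀ᵐ ω ∂P', Tendsto (fun n => ∑ j ∈ Finset.range n, ξ j ω * u k (f j)) atTop
      (𝓝 (U k ω)) := by
    intro k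
    filter_upwards [(hUi k).tendsto_ae_condExp (hUm k), ae_all_iff.2 (hU k)] with ω h1 h2
    -- The σ-algebra of index `n` already contains `ξ n`, hence sums over `range (n + 1)`.
    rw [← tendsto_add_atTop_iff_nat 1]
    exact h1.congr h2
  have hUmeas : ∀ k, Measurable (U k) := fun k => ((hUm k).mono hℱ).measurable
  have hlaw := map_dual_eq_map_of_tendsto hX hξ hS hf hUmeas hUt
  have hJm : Measurable fun (x : E) k => u k x := by fun_prop
  -- Lusin–Souslin: an injective Borel map on a Polish space has measurable image and measurable
  -- inverse.
  have hJ : MeasurableEmbedding fun (x : E) k => u k x := hJm.measurableEmbedding hu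
  have hJX : AEMeasurable (fun ω k => u k (X ω)) P :=
    hJm.comp_aemeasurable hX.gaussian.aemeasurable
  let Y : Ω' → E := fun ω => hJ.invFun fun k => U k ω
  have hUpi : Measurable fun ω k => U k ω := measurable_pi_lambda _ hUmeas
  have hYm : StronglyMeasurable[⨆ n, ℱ n] Y :=
    (hJ.measurable_invFun.comp
      (@measurable_pi_lambda _ _ _ (⨆ n, ℱ n) _ (fun ω k => U k ω)
        fun k => (hUm k).measurable)).stronglyMeasurable
  have hXY : IdentDistrib X Y P P' := by
    refine ⟨hX.gaussian.aemeasurable, (hYm.mono hℱ).measurable.aemeasurable, ?_⟩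
    have h1 := congrArg (Measure.map hJ.invFun) hlaw
    rw [Measure.map_map hJ.measurable_invFun hUpi, AEMeasurable.map_map_of_aemeasurable
      hJ.measurable_invFun.aemeasurable hJX] at h1
    refine Eq.trans ?_ h1
    congr 1
    ext ω
    exact (hJ.leftInverse_invFun (X ω)).symm
  -- Lying in the image of `E` is a property of the law, so it transfers from `(u_k(X))_k` to
  -- `(U_k)_k`.
  have hJY : ∀ᵐ ω ∂P', ∀ k, u k (Y ω) = U k ω := by
    have h1 : ∀ᵐ y ∂(P'.map fun ω k => U k ω), y ∈ Set.range fun (x : E) k => u k x := by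
      rw [← hlaw]
      exact (ae_map_iff hJX hJ.measurableSet_range).2 (.of_forall fun ω => ⟨X ω, rfl⟩)
    filter_upwards [ae_of_ae_map hUpi.aemeasurable h1] with ω ⟨x, hx⟩ k
    have h2 : Y ω = x := by
      simp only [Y, ← hx]
      exact hJ.leftInverse_invFun x
    rw [h2]
    exact congrFun hx k
  have hYi : Integrable Y P' := hXY.integrable_iff.1 hX.gaussian.integrable
  refine ⟨Y, ?_, hXY⟩
  have hcond : ∀ n, P'[Y | ℱ n] =ᵐ[P'] fun ω => ∑ j ∈ Finset.range (n + 1), ξ j ω • f j := by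
    intro n
    have h1 : ∀ k, ∀ᵐ ω ∂P', u k ((P'[Y | ℱ n]) ω) =
        ∑ j ∈ Finset.range (n + 1), ξ j ω * u k (f j) := by
      intro k
      have h2 : P'[u k ∘ Y | ℱ n] =ᵐ[P'] P'[U k | ℱ n] :=
        condExp_congr_ae (hJY.mono fun ω h => h k)
      filter_upwards [(u k).comp_condExp_comm (m := ℱ n) hYi, h2, hU k n] with ω h3 h4 h5
      exact h3.trans (h4.trans h5)
    filter_upwards [ae_all_iff.2 h1] with ω h
    refine hu (funext fun k => ?_)
    simp [h k, map_sum]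
  filter_upwards [tendsto_ae_condExp_of_stronglyMeasurable ℱ hYi hYm, ae_all_iff.2 hcond]
    with ω h1 h2
  rw [← tendsto_add_atTop_iff_nat 1]
  exact h1.congr h2

/-- The weak variances of an admissible series are those of `X`. -/
theorem IsAdmissible.tendsto_sum_sq (h : IsAdmissible ξ P' f X P) (hX : IsCenteredGaussian X P)
    (hξ : IsStdGaussianSeq ξ P')
    (hS : ∀ u : StrongDual ℝ E, covarianceOperator X P u = S (dualAdjoint S u))
    (u : StrongDual ℝ E) :
    Tendsto (fun n => ∑ j ∈ Finset.range n, u (f j) ^ 2) atTop (𝓝 (‖dualAdjoint S u‖ ^ 2)) := by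
  obtain ⟨Y, hY, hXY⟩ := h
  have hW : ∀ᵐ ω ∂P', Tendsto (fun n => ∑ j ∈ Finset.range n, ξ j ω * u (f j)) atTop
      (𝓝 (u (Y ω))) := by
    filter_upwards [hY] with ω hω
    refine ((u.continuous.tendsto _).comp hω).congr fun n => ?_
    simp
  have h1 := hξ.tendsto_exp_sum_sq hW
  have h2 := (hXY.comp (u := fun x => Complex.exp ((u x : ℂ) * Complex.I))
    (by fun_prop)).integral_eq
  simp only [Function.comp_def] at h2
  rw [← h2, hX.integral_exp_dual hS] at h1
  have h3 := (Complex.continuous_re.tendsto _).comp h1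
  simp only [Function.comp_def, Complex.ofReal_re] at h3
  -- The factor `-2` cancels the `-1/2` in the Gaussian exponent.
  have h4 := (h3.log (Real.exp_ne_zero _)).const_mul (-2)
  simp only [Real.log_exp] at h4
  convert h4 using 2 <;> ring_nf

end GaussianSeries

theorem proposition1 {Ω Ω' E K : Type*}
    [MeasurableSpace Ω] [MeasurableSpace Ω']
    [NormedAddCommGroup E] [NormedSpace ℝ E] [CompleteSpace E]
    [TopologicalSpace.SeparableSpace E] [MeasurableSpace E] [BorelSpace E]
    [NormedAddCommGroup K] [InnerProductSpace ℝ K] [CompleteSpace K]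
    [TopologicalSpace.SeparableSpace K]
    (P : Measure Ω) [IsProbabilityMeasure P]
    (X : Ω → E) (hX : GaussianSeries.IsCenteredGaussian X P)
    (P' : Measure Ω') [IsProbabilityMeasure P']
    (ξ : ℕ → Ω' → ℝ) (hξ : GaussianSeries.IsStdGaussianSeq ξ P')
    (S : K →L[ℝ] E)
    (hS : ∀ u : StrongDual ℝ E,
      GaussianSeries.covarianceOperator X P u = S (GaussianSeries.dualAdjoint S u)) :
    (∀ e : ℕ → K, GaussianSeries.IsParsevalFrameSeq e →
      (LinearMap.ker S.toLinearMap)ᗮ ≤ GaussianSeries.closedSpan e →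
      GaussianSeries.IsAdmissible ξ P' (fun j => S (e j)) X P) ∧
    (∀ f : ℕ → E, GaussianSeries.IsAdmissible ξ P' f X P →
      ∃ e : ℕ → K, GaussianSeries.IsParsevalFrameSeq e ∧
        (LinearMap.ker S.toLinearMap)ᗮ = GaussianSeries.closedSpan e ∧
        ∀ j, S (e j) = f j) := by
  refine ⟨fun e he hle => ?_, fun f hf => ?_⟩
  · refine GaussianSeries.isAdmissible_of_tendsto hX hξ hS fun u => ?_
    refine (he.tendsto_sum_inner_sq
      (hle (GaussianSeries.dualAdjoint_mem_orthogonal_ker S u))).congr fun n =>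
        Finset.sum_congr rfl fun j _ => ?_
    rw [real_inner_comm, GaussianSeries.inner_dualAdjoint]
  · have hsum := hf.tendsto_sum_sq hX hξ hS
    have hbound : ∀ j (u : StrongDual ℝ E), |u (f j)| ≤ ‖GaussianSeries.dualAdjoint S u‖ := by
      intro j u
      refine abs_le_of_sq_le_sq ?_ (norm_nonneg _)
      -- One term of a nonnegative series is at most its sum.
      exact le_hasSum ((hasSum_iff_tendsto_nat_of_nonneg (fun _ => sq_nonneg _) _).2 (hsum u)) j
        fun _ _ => sq_nonneg _
    choose e he heS using fun j =>
      GaussianSeries.exists_mem_orthogonal_ker_apply_eq S (f j) (hbound j)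
    rw [GaussianSeries.orthogonal_ker_eq_closure_range] at he ⊢
    obtain ⟨h1, h2⟩ := GaussianSeries.isParsevalFrameSeq_of_tendsto he (by
      rintro _ ⟨u, rfl⟩
      refine (hsum u).congr fun n => Finset.sum_congr rfl fun j _ => ?_
      rw [GaussianSeries.dualAdjointLinear_apply, real_inner_comm,
        GaussianSeries.inner_dualAdjoint, heS])
    exact ⟨e, h1, h2.symm, heS⟩
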